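/- \textbf{Setting.} Let $S$ be a separable complete metric space, $A\subseteq\mathbb R^k$ a Borel set, $\Gamma(s)\subseteq A$ a Borel set of feasible actions for each $s\in S$, $p$ a (Borel measurable) transition probability from $S\times A$ to $S$, $r:S\times A\to\mathbb R$ a bounded Borel function and $0<\beta<1$. A \emph{strategy} $\sigma=(\sigma_1,\sigma_2,\dots)$ consists of Borel maps $\sigma_t:S\times(A\times S)^{t-1}\to A$ with $\sigma_t(s(1),a(1),\dots,s(t))\in\Gamma(s(t))$. For an initial state $s(1)=s$, $\sigma$ and $p$ determine the law of $(s(t),a(t))_{t\ge1}$, where $a(t)=\sigma_t(s(1),a(1),\dots,s(t))$ and $s(t+1)$ is drawn from $p(s(t),a(t),\cdot)$. Put $V_\sigma(s)=\mathbb E_\sigma\sum_{t\ge1}\beta^{t-1}r(s(t),a(t))$ and $V(s)=\sup_\sigma V_\sigma(s)$, the value function. A \emph{stationary policy} is a Borel map $\lambda:S\to A$ with $\lambda(s)\in\Gamma(s)$ for all $s$; it is identified with the strategy that always plays $\lambda(s(t))$. A strategy $\sigma$ is \emph{optimal} if $V_\sigma=V$ on $S$, and \emph{$\epsilon$-optimal}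 if $V_{\sigma'}(s)\le V_\sigma(s)+\epsilon$ for all strategies $\sigma'$ and all $s\in S$. Let $Q(s,a,f)=r(s,a)+\beta\int_S f(s')\,p(s,a,ds')$, $Tf(s)=\sup_{a\in\Gamma(s)}Q(s,a,f)$ (the Bellman operator), and let $\Lambda_f$ be the set of stationary policies $\lambda$ with $Q(s,\lambda(s),f)=Tf(s)$ for all $s\in S$. Let $B_m(S)$ be the set of bounded Borel functions $S\to\mathbb R$ with the metric $d_\infty(f,g)=\sup_s|f(s)-g(s)|$. \textbf{Theorem.} Let $D\subseteq B_m(S)$ be a subset that is complete in the metric $d_\infty$ and contains all constant functions. Assume that $\Lambda_f\neq\emptyset$ and $Tf\in D$ for every $f\in D$. Then: \begin{enumerate} \item $V\in D$, $TV=V$, and $V$ is the only $f\in D$ with $Tf=f$. \item There is a stationary policy $\lambda\in\Lambda_V$ that is $\epsilon$-optimal for every $\epsilon>0$. \item Every $\lambda\in\Lambda_V$ (that is, every stationary policy attaining the supremum in $TV(s)$ for all $s$) is an optimal stationary policy. \end{enumerate} Moreover: \begin{enumerate} \item[4.] For every $f\in D$, the sequence $T^nf$ converges to $V$ uniformly on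 $S$. \item[5.] If $D'\subseteq D$ is nonempty and closed in $B_m(S)$, and $Tf\in D'$ for every $f\in D'$, then $V\in D'$. \end{enumerate} -/

import Mathlib

open MeasureTheory ProbabilityTheory Filter Topology

/-- The space `B_m(S)` of bounded measurable functions `S → ℝ`. -/
def BoundedMeasurable (S : Type*) [MeasurableSpace S] : Type _ :=
  {f : S → ℝ // Measurable f ∧ ∃ M : ℝ, ∀ s, |f s| ≤ M}

namespace BoundedMeasurable

variable {S : Type*} [MeasurableSpace S]

instance : CoeFun (BoundedMeasurable S) (fun _ => S → ℝ) := ⟨fun f => f.1⟩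

/-- The constant function `c`. -/
def const (S : Type*) [MeasurableSpace S] (c : ℝ) : BoundedMeasurable S :=
  ⟨fun _ => c, measurable_const, |c|, fun _ => le_rfl⟩

theorem bddAbove_dist (f g : BoundedMeasurable S) :
    BddAbove (Set.range fun s => |f s - g s|) := by
  obtain ⟨M, hM⟩ := f.2.2
  obtain ⟨N, hN⟩ := g.2.2
  refine ⟨M + N, ?_⟩
  rintro _ ⟨s, rfl⟩
  exact (abs_sub _ _).trans (add_le_add (hM s) (hN s))

/-- The supremum metric `d_∞(f, g) = sup_s |f(s) - g(s)|`. -/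
noncomputable instance : MetricSpace (BoundedMeasurable S) where
  dist f g := ⨆ s, |f s - g s|
  dist_self f := by simp
  dist_comm f g := by simp only [abs_sub_comm]
  dist_triangle f g h := by
    refine Real.iSup_le (fun s => ?_) ?_
    · exact (abs_sub_le (f s) (g s) (h s)).trans
        (add_le_add (le_ciSup (bddAbove_dist f g) s) (le_ciSup (bddAbove_dist g h) s))
    · exact add_nonneg (Real.iSup_nonneg fun _ => abs_nonneg _)
        (Real.iSup_nonneg fun _ => abs_nonneg _)
  eq_of_dist_eq_zero {f g} h := by
    refine Subtype.ext (funext fun s => ?_)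
    have h1 : |f s - g s| ≤ 0 := (le_ciSup (bddAbove_dist f g) s).trans (le_of_eq h)
    exact sub_eq_zero.mp (abs_nonpos_iff.mp h1)

end BoundedMeasurable

/-- An infinite-horizon discounted dynamic program with state space `S` and action space `A`. -/
structure DiscountedDP (S A : Type*) [MeasurableSpace S] [MeasurableSpace A] where
  /-- the set of feasible actions in each state -/
  Γ : S → Set A
  measurableSet_Γ : ∀ s, MeasurableSet (Γ s)
  /-- the transition probability function -/
  p : Kernel (S × A) S
  isMarkovKernel_p : IsMarkovKernel p
  /-- the single-period payoff -/
  r : S × A → ℝ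
  measurable_r : Measurable r
  /-- the discount factor -/
  β : ℝ
  β_pos : 0 < β
  β_lt_one : β < 1

namespace DiscountedDP

variable {S A : Type*} [MeasurableSpace S] [MeasurableSpace A]

instance (M : DiscountedDP S A) : IsMarkovKernel M.p := M.isMarkovKernel_p

/-- A (deterministic, history-dependent) strategy. Periods are numbered from `0`: `act n (h, s)` is
the action taken in period `n` when the past state-action pairs are `h 0, …, h (n - 1)` and the
current state is `s`. -/
structure Strategy (M : DiscountedDP S A) where
  act : (n : ℕ) → (Fin n → S × A) × S → A
  measurable_act : ∀ n, Measurable (act n)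
  feasible : ∀ n (h : Fin n → S × A) (s : S), act n (h, s) ∈ M.Γ s

/-- A stationary policy: a measurable map choosing a feasible action in every state. -/
structure StationaryPolicy (M : DiscountedDP S A) where
  act : S → A
  measurable_act : Measurable act
  feasible : ∀ s, act s ∈ M.Γ s

/-- The strategy that plays the stationary policy `l` after every history. -/
def StationaryPolicy.toStrategy {M : DiscountedDP S A} (l : M.StationaryPolicy) : M.Strategy where
  act _ x := l.act x.2
  measurable_act _ := l.measurable_act.comp measurable_snd
  feasible _ _ s := l.feasible s

/-- The state-action pairs of periods `0, …, n`, indexed by `Fin (n + 1)`. -/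
def past {S A : Type*} (n : ℕ) (h : (i : Finset.Iic n) → S × A) : Fin (n + 1) → S × A :=
  fun i => h ⟨i.1, Finset.mem_Iic.mpr (Nat.lt_succ_iff.mp i.2)⟩

/-- The state-action pair of period `n`. -/
def last {S A : Type*} (n : ℕ) (h : (i : Finset.Iic n) → S × A) : S × A :=
  h ⟨n, Finset.mem_Iic.mpr le_rfl⟩

/-- The state-action pair of period `n + 1`, given the earlier ones and the new state. -/
def nextPair {M : DiscountedDP S A} (σ : M.Strategy) (n : ℕ)
    (x : ((i : Finset.Iic n) → S × A) × S) : S × A :=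
  (x.2, σ.act (n + 1) (past n x.1, x.2))

theorem measurable_past (n : ℕ) : Measurable (past (S := S) (A := A) n) :=
  measurable_pi_lambda _ fun _ => measurable_pi_apply _

theorem measurable_last (n : ℕ) : Measurable (last (S := S) (A := A) n) :=
  measurable_pi_apply _

theorem measurable_nextPair {M : DiscountedDP S A} (σ : M.Strategy) (n : ℕ) :
    Measurable (nextPair σ n) :=
  measurable_snd.prodMk ((σ.measurable_act (n + 1)).comp
    (((measurable_past n).comp measurable_fst).prodMk measurable_snd))

/-- The conditional law of the state-action pair of period `n + 1` given those of periods
`0, …, n`: the new state is drawn from `p` at the pair of period `n`, and the action is the one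
prescribed by `σ`. -/
noncomputable def stepKernel {M : DiscountedDP S A} (σ : M.Strategy) (n : ℕ) :
    Kernel ((i : Finset.Iic n) → S × A) (S × A) :=
  (Kernel.id ×ₖ M.p.comap (last n) (measurable_last n)).map (nextPair σ n)

instance {M : DiscountedDP S A} (σ : M.Strategy) (n : ℕ) : IsMarkovKernel (stepKernel σ n) :=
  Kernel.IsMarkovKernel.map _ (measurable_nextPair σ n)

/-- The law, on the space of infinite sequences of state-action pairs, of the process that starts
in the state `s` and is controlled by `σ` (Ionescu-Tulcea). -/
noncomputable def pathMeasure {M : DiscountedDP S A} (σ : M.Strategy) (s : S) :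
    Measure (ℕ → S × A) :=
  Kernel.traj (X := fun _ => S × A) (stepKernel σ) 0
    (fun _ => (s, σ.act 0 (Fin.elim0, s)))

/-- The expected discounted payoff `V_σ(s)`. -/
noncomputable def payoff {M : DiscountedDP S A} (σ : M.Strategy) (s : S) : ℝ :=
  ∫ ω, ∑' t : ℕ, M.β ^ t * M.r (ω t) ∂(pathMeasure σ s)

/-- The value function `V(s) = sup_σ V_σ(s)`. -/
noncomputable def value (M : DiscountedDP S A) (s : S) : ℝ :=
  ⨆ σ : M.Strategy, payoff σ s

/-- A strategy is optimal if its payoff is the value function. -/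
def IsOptimal {M : DiscountedDP S A} (σ : M.Strategy) : Prop :=
  ∀ s, payoff σ s = M.value s

/-- A strategy is `ε`-optimal if no strategy improves on it by more than `ε` in any state. -/
def IsEpsOptimal {M : DiscountedDP S A} (ε : ℝ) (σ : M.Strategy) : Prop :=
  ∀ (σ' : M.Strategy) (s : S), payoff σ' s ≤ payoff σ s + ε

/-- `Q(s, a, f) = r(s, a) + β ∫ f(s') p(s, a, ds')`. -/
noncomputable def Q (M : DiscountedDP S A) (s : S) (a : A) (f : S → ℝ) : ℝ :=
  M.r (s, a) + M.β * ∫ s', f s' ∂(M.p (s, a))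

/-- The Bellman operator `Tf(s) = sup_{a ∈ Γ(s)} Q(s, a, f)`. -/
noncomputable def bellman (M : DiscountedDP S A) (f : S → ℝ) (s : S) : ℝ :=
  ⨆ a : M.Γ s, M.Q s a f

/-- The set `Λ_f` of stationary policies that attain the supremum defining `Tf` in every state. -/
def maximizers (M : DiscountedDP S A) (f : S → ℝ) : Set M.StationaryPolicy :=
  {l | ∀ s, M.bellman f s = M.Q s (l.act s) f}

end DiscountedDP

namespace BoundedMeasurable

variable {S : Type*} [MeasurableSpace S]

/-! The Bellman operator is a `β`-contraction for `d_∞`, so on the complete set `D` it has a fixed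
point `v` to which all iterates converge. It remains to identify `v` with the value function. For
any bounded measurable `v`, let `gap` be `Q(s, a, v) - v(s)`. Conditioning on the current pair
writes the expected reward at time `t` as the expected gap plus `E v(s_t) - β E v(s_{t+1})`.
Discounting and telescoping give `payoff σ s - v s = ∑ β^t E gap` (`hasSum_gap`). If `v` is a fixed
point, gaps are nonpositive at feasible actions and vanish along a maximizing policy. Hence `v`
bounds every payoff and is attained. This also yields uniqueness, since every fixed point in `D` is
the value function (`value_eq_of_bellman_eq`). -/

theorem abs_sub_le_dist (f g : BoundedMeasurable S) (s : S) : |f s - g s| ≤ dist f g :=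
  le_ciSup (bddAbove_dist f g) s

theorem dist_le {f g : BoundedMeasurable S} {c : ℝ} (hc : 0 ≤ c) (h : ∀ s, |f s - g s| ≤ c) :
    dist f g ≤ c :=
  Real.iSup_le h hc

theorem integrable (f : BoundedMeasurable S) (μ : Measure S) [IsFiniteMeasure μ] :
    Integrable f μ := by
  obtain ⟨N, hN⟩ := f.2.2
  exact .of_bound f.2.1.aestronglyMeasurable N (.of_forall hN)

end BoundedMeasurable

theorem abs_integral_le_of_abs_le {Ω : Type*} [MeasurableSpace Ω] (μ : Measure Ω)
    [IsProbabilityMeasure μ] {f : Ω → ℝ} {N : ℝ} (hf : ∀ x, |f x| ≤ N) : |∫ x, f x ∂μ| ≤ N := by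
  simpa using norm_integral_le_of_norm_le_const (μ := μ) (f := f) (C := N) (.of_forall hf)

namespace DiscountedDP

variable {S A : Type*} [MeasurableSpace S] [MeasurableSpace A]

/-! ### The Bellman operator as a contraction. -/

section Bellman

variable (M : DiscountedDP S A)

theorem measurable_Q {f : S → ℝ} (hf : Measurable f) :
    Measurable fun x : S × A => M.Q x.1 x.2 f :=
  M.measurable_r.add
    ((hf.stronglyMeasurable.integral_kernel (κ := M.p)).measurable.const_mul _)

theorem abs_Q_le {C : ℝ} (hr : ∀ x, |M.r x| ≤ C) {f : S → ℝ} {N : ℝ} (hf : ∀ s, |f s| ≤ N)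
    (s : S) (a : A) : |M.Q s a f| ≤ C + M.β * N := by
  have h : |∫ s', f s' ∂(M.p (s, a))| ≤ N := abs_integral_le_of_abs_le _ hf
  refine (abs_add_le _ _).trans (add_le_add (hr _) ?_)
  rw [abs_mul, abs_of_pos M.β_pos]
  exact mul_le_mul_of_nonneg_left h M.β_pos.le

theorem bddAbove_Q (hr : ∃ C : ℝ, ∀ x, |M.r x| ≤ C) (f : BoundedMeasurable S) (s : S) :
    BddAbove (Set.range fun a : M.Γ s => M.Q s a f) := by
  obtain ⟨C, hC⟩ := hr
  obtain ⟨N, hN⟩ := f.2.2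
  exact ⟨C + M.β * N, Set.forall_mem_range.2 fun a =>
    (le_abs_self _).trans (M.abs_Q_le hC hN s a)⟩

theorem Q_le_bellman (hr : ∃ C : ℝ, ∀ x, |M.r x| ≤ C) (f : BoundedMeasurable S) {s : S} {a : A}
    (ha : a ∈ M.Γ s) : M.Q s a f ≤ M.bellman f s :=
  le_ciSup (M.bddAbove_Q hr f s) ⟨a, ha⟩

/-- Integrate `f ≤ g + dist f g` against the probability `p(s, a)`, which preserves the constant.
The one-sided form passes directly to suprema over actions. -/
theorem Q_le_Q_add (f g : BoundedMeasurable S) (s : S) (a : A) :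
    M.Q s a f ≤ M.Q s a g + M.β * dist f g := by
  have h : ∫ s', f s' ∂(M.p (s, a)) ≤ ∫ s', (g s' + dist f g) ∂(M.p (s, a)) :=
    integral_mono (f.integrable _) ((g.integrable _).add (integrable_const _)) fun s' => by
      have := (le_abs_self _).trans (f.abs_sub_le_dist g s')
      linarith
  rw [integral_add (g.integrable _) (integrable_const _)] at h
  simp only [integral_const, probReal_univ, one_smul] at h
  have := mul_le_mul_of_nonneg_left h M.β_pos.le
  simp only [Q]
  linarith

theorem bellman_le_bellman_add (hr : ∃ C : ℝ, ∀ x, |M.r x| ≤ C) (hΓ : ∀ s, (M.Γ s).Nonempty)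
    (f g : BoundedMeasurable S) (s : S) :
    M.bellman f s ≤ M.bellman g s + M.β * dist f g :=
  have := (hΓ s).to_subtype
  ciSup_le fun a => (M.Q_le_Q_add f g s a).trans
    (add_le_add_left (M.Q_le_bellman hr g a.2) _)

theorem abs_bellman_sub_le (hr : ∃ C : ℝ, ∀ x, |M.r x| ≤ C) (hΓ : ∀ s, (M.Γ s).Nonempty)
    (f g : BoundedMeasurable S) (s : S) :
    |M.bellman f s - M.bellman g s| ≤ M.β * dist f g := by
  have h1 := M.bellman_le_bellman_add hr hΓ f g s
  have h2 := M.bellman_le_bellman_add hr hΓ g f s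
  rw [dist_comm] at h2
  rw [abs_le]
  constructor <;> linarith

end Bellman

/-! ### Expectations along the controlled process and the telescoping identity. -/

section Paths

variable {M : DiscountedDP S A} (σ : M.Strategy) (s : S)

instance : IsProbabilityMeasure (pathMeasure σ s) :=
  inferInstanceAs (IsProbabilityMeasure (Kernel.traj (X := fun _ => S × A) (stepKernel σ) 0 _))

theorem integrable_eval {g : S × A → ℝ} (hg : Measurable g) (hb : ∃ C : ℝ, ∀ x, |g x| ≤ C)
    (n : ℕ) : Integrable (fun ω : ℕ → S × A => g (ω n)) (pathMeasure σ s) := by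
  obtain ⟨C, hC⟩ := hb
  exact .of_bound (hg.comp (measurable_pi_apply n)).aestronglyMeasurable C
    (.of_forall fun _ => hC _)

theorem integral_stepKernel {g : S × A → ℝ} (hg : Measurable g) (n : ℕ)
    (x : (i : Finset.Iic n) → S × A) :
    ∫ z, g z ∂(stepKernel σ n x) = ∫ s', g (nextPair σ n (x, s')) ∂(M.p (last n x)) := by
  have hm := measurable_nextPair σ n
  rw [stepKernel, Kernel.map_apply _ hm, Kernel.prod_apply, Kernel.id_apply, Kernel.comap_apply,
    Measure.dirac_prod, Measure.map_map hm measurable_prodMk_left,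
    integral_map (hm.comp measurable_prodMk_left).aemeasurable hg.aestronglyMeasurable]
  rfl

/-- The law of the first `n + 1` state-action pairs. -/
noncomputable def pastMeasure (n : ℕ) : Measure ((i : Finset.Iic n) → S × A) :=
  Kernel.partialTraj (X := fun _ => S × A) (stepKernel σ) 0 n
    (fun _ => (s, σ.act 0 (Fin.elim0, s)))

theorem map_pathMeasure (n : ℕ) :
    (pathMeasure σ s).map (Preorder.frestrictLe n) = pastMeasure σ s n :=
  Kernel.traj_map_frestrictLe_apply 0 n _

theorem integral_eval_zero {g : S × A → ℝ} (hg : Measurable g) :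
    ∫ ω, g (ω 0) ∂(pathMeasure σ s) = g (s, σ.act 0 (Fin.elim0, s)) := by
  have h := map_pathMeasure σ s 0
  rw [pastMeasure, Kernel.partialTraj_self, Kernel.id_apply] at h
  have hl := hg.comp (measurable_last (S := S) (A := A) 0)
  calc ∫ ω, g (ω 0) ∂(pathMeasure σ s)
      = ∫ x, g (last 0 x) ∂((pathMeasure σ s).map (Preorder.frestrictLe 0)) :=
        (integral_map (φ := Preorder.frestrictLe (π := fun _ => S × A) 0)
          (Preorder.measurable_frestrictLe 0).aemeasurable hl.aestronglyMeasurable).symm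
    _ = _ := by
        rw [h]
        exact integral_dirac' _ _ hl.stronglyMeasurable

/-- Condition on the first `n + 1` pairs: under the trajectory kernel from time `n`, the next
coordinate has law `stepKernel σ n`. -/
theorem integral_eval_succ {g : S × A → ℝ} (hg : Measurable g) (hb : ∃ C : ℝ, ∀ x, |g x| ≤ C)
    (n : ℕ) :
    ∫ ω, g (ω (n + 1)) ∂(pathMeasure σ s) =
      ∫ x, ∫ s', g (nextPair σ n (x, s')) ∂(M.p (last n x)) ∂(pastMeasure σ s n) := by
  have h := Kernel.integral_traj_partialTraj (X := fun _ => S × A) (κ := stepKernel σ)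
    (Nat.zero_le n) (integrable_eval σ s hg hb (n + 1))
  rw [pathMeasure, pastMeasure, ← h]
  refine integral_congr_ae (.of_forall fun x => ?_)
  change ∫ y, g (y (n + 1)) ∂(Kernel.traj (X := fun _ => S × A) (stepKernel σ) n x) =
    ∫ s', g (nextPair σ n (x, s')) ∂(M.p (last n x))
  rw [← integral_stepKernel σ hg n x,
    ← Kernel.map_traj_succ_self (X := fun _ => S × A) (κ := stepKernel σ) (a := n),
    Kernel.map_apply _ (measurable_pi_apply _),
    integral_map (measurable_pi_apply _).aemeasurable hg.aestronglyMeasurable]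

theorem integral_state_succ (v : BoundedMeasurable S) (n : ℕ) :
    ∫ ω, v (ω (n + 1)).1 ∂(pathMeasure σ s) =
      ∫ ω, ∫ s', v s' ∂(M.p (ω n)) ∂(pathMeasure σ s) := by
  rw [integral_eval_succ (g := fun x => v x.1) σ s (v.2.1.comp measurable_fst)
    (v.2.2.imp fun _ h x => h x.1), ← map_pathMeasure,
    integral_map (Preorder.measurable_frestrictLe n).aemeasurable]
  · rfl
  · exact ((v.2.1.stronglyMeasurable.integral_kernel (κ := M.p)).comp_measurable
      (measurable_last n)).aestronglyMeasurable

/-- The sign of `g` is required only at pairs that `σ` can produce, because a gap may be positive at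
infeasible actions. Integrating over the new state, with the action then prescribed by `σ`, avoids
any measurability of the graph of `Γ`. -/
theorem integral_eval_nonpos {g : S × A → ℝ} (hg : Measurable g)
    (hb : ∃ C : ℝ, ∀ x, |g x| ≤ C) (h : ∀ n k s, g (s, σ.act n (k, s)) ≤ 0) (n : ℕ) :
    ∫ ω, g (ω n) ∂(pathMeasure σ s) ≤ 0 := by
  cases n with
  | zero => rw [integral_eval_zero σ s hg]; exact h 0 _ s
  | succ n =>
    rw [integral_eval_succ σ s hg hb]
    exact integral_nonpos fun x => integral_nonpos fun s' => h (n + 1) _ s'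

theorem integral_eval_eq_zero {g : S × A → ℝ} (hg : Measurable g)
    (hb : ∃ C : ℝ, ∀ x, |g x| ≤ C) (h : ∀ n k s, g (s, σ.act n (k, s)) = 0) (n : ℕ) :
    ∫ ω, g (ω n) ∂(pathMeasure σ s) = 0 := by
  refine (integral_eval_nonpos σ s hg hb (fun n k s => (h n k s).le) n).antisymm ?_
  have := integral_eval_nonpos σ s (g := fun x => -g x) hg.neg (by simpa using hb)
    (fun n k s => by simp [h]) n
  rw [integral_neg] at this
  linarith

/-- The geometric bound `β^t C` on the terms permits exchanging sum and expectation. -/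
theorem hasSum_payoff (hr : ∃ C : ℝ, ∀ x, |M.r x| ≤ C) :
    HasSum (fun t => M.β ^ t * ∫ ω, M.r (ω t) ∂(pathMeasure σ s)) (payoff σ s) := by
  have hi := integrable_eval σ s M.measurable_r hr
  obtain ⟨C, hC⟩ := hr
  have h := hasSum_integral_of_summable_integral_norm (μ := pathMeasure σ s)
    (F := fun t ω => M.β ^ t * M.r (ω t)) (fun t => (hi t).const_mul _) ?_
  · simpa only [integral_const_mul, payoff] using h
  · refine .of_nonneg_of_le (fun t => integral_nonneg fun _ => norm_nonneg _) (fun t => ?_)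
      ((summable_geometric_of_lt_one M.β_pos.le M.β_lt_one).mul_right C)
    have := integral_mono (μ := pathMeasure σ s) ((hi t).const_mul (M.β ^ t)).norm
      (integrable_const (M.β ^ t * C)) fun ω => by
        rw [norm_mul, Real.norm_of_nonneg (pow_nonneg M.β_pos.le t)]
        exact mul_le_mul_of_nonneg_left (hC _) (pow_nonneg M.β_pos.le t)
    simpa using this

/-- The gap `Q(s, a, v) - v(s)` between the one-step lookahead value of `a` and `v`. -/
noncomputable def gap (M : DiscountedDP S A) (v : S → ℝ) (x : S × A) : ℝ :=
  M.Q x.1 x.2 v - v x.1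

theorem measurable_gap (M : DiscountedDP S A) {v : S → ℝ} (hv : Measurable v) :
    Measurable (M.gap v) :=
  (M.measurable_Q hv).sub (hv.comp measurable_fst)

theorem gap_bounded (M : DiscountedDP S A) (hr : ∃ C : ℝ, ∀ x, |M.r x| ≤ C)
    (v : BoundedMeasurable S) : ∃ C : ℝ, ∀ x, |M.gap v x| ≤ C := by
  obtain ⟨C, hC⟩ := hr
  obtain ⟨N, hN⟩ := v.2.2
  exact ⟨C + M.β * N + N, fun x =>
    (abs_sub _ _).trans (add_le_add (M.abs_Q_le hC hN _ _) (hN _))⟩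

theorem integral_reward (hr : ∃ C : ℝ, ∀ x, |M.r x| ≤ C) (v : BoundedMeasurable S) (t : ℕ) :
    ∫ ω, M.r (ω t) ∂(pathMeasure σ s) = ∫ ω, M.gap v (ω t) ∂(pathMeasure σ s) +
      (∫ ω, v (ω t).1 ∂(pathMeasure σ s) -
        M.β * ∫ ω, v (ω (t + 1)).1 ∂(pathMeasure σ s)) := by
  have h1 := integrable_eval σ s (M.measurable_gap v.2.1) (M.gap_bounded hr v) t
  have h2 : Integrable (fun ω : ℕ → S × A => v (ω t).1) (pathMeasure σ s) :=
    integrable_eval σ s (v.2.1.comp (measurable_fst (β := A))) (v.2.2.imp fun _ h x => h x.1) t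
  have h3 : Integrable (fun ω : ℕ → S × A => ∫ s', v s' ∂(M.p (ω t))) (pathMeasure σ s) :=
    integrable_eval σ s (g := fun x => ∫ s', v s' ∂(M.p x))
      (v.2.1.stronglyMeasurable.integral_kernel (κ := M.p)).measurable
      (v.2.2.imp fun N h x => abs_integral_le_of_abs_le _ h) t
  have h4 : Integrable (fun ω : ℕ → S × A => v (ω t).1 - M.β * ∫ s', v s' ∂(M.p (ω t)))
      (pathMeasure σ s) := h2.sub (h3.const_mul _)
  rw [integral_state_succ, ← integral_const_mul, ← integral_sub h2 (h3.const_mul _),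
    ← integral_add h1 h4]
  refine integral_congr_ae (.of_forall fun ω => ?_)
  simp only [gap, Q]
  ring

/-- The payoff of a strategy differs from any bounded measurable function by the expected
discounted sum of the gaps. -/
theorem hasSum_gap (hr : ∃ C : ℝ, ∀ x, |M.r x| ≤ C) (v : BoundedMeasurable S) :
    HasSum (fun t => M.β ^ t * ∫ ω, M.gap v (ω t) ∂(pathMeasure σ s))
      (payoff σ s - v s) := by
  set e : ℕ → ℝ := fun t => ∫ ω, v (ω t).1 ∂(pathMeasure σ s) with he
  have he0 : e 0 = v s :=
    integral_eval_zero σ s (v.2.1.comp (measurable_fst (β := A)))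
  obtain ⟨N, hN⟩ := v.2.2
  have hsum : Summable fun t => M.β ^ t * e t := by
    refine .of_norm_bounded
      ((summable_geometric_of_lt_one M.β_pos.le M.β_lt_one).mul_right N) fun t => ?_
    rw [norm_mul, Real.norm_of_nonneg (pow_nonneg M.β_pos.le t)]
    refine mul_le_mul_of_nonneg_left ?_ (pow_nonneg M.β_pos.le t)
    exact abs_integral_le_of_abs_le _ fun ω : ℕ → S × A => hN (ω t).1
  have htel : HasSum (fun t => M.β ^ t * e t - M.β ^ (t + 1) * e (t + 1)) (v s) := by
    -- The series minus its tail from index `1` leaves only the term `e 0 = v s`.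
    have h := hsum.hasSum.sub ((hasSum_nat_add_iff' 1).2 hsum.hasSum)
    simpa [he0] using h
  refine ((hasSum_payoff σ s hr).sub htel).congr_fun fun t => ?_
  rw [integral_reward σ s hr v t]
  simp only [he]
  ring

theorem payoff_le_of_gap_nonpos (hr : ∃ C : ℝ, ∀ x, |M.r x| ≤ C) (v : BoundedMeasurable S)
    (h : ∀ n k s, M.gap v (s, σ.act n (k, s)) ≤ 0) : payoff σ s ≤ v s :=
  sub_nonpos.1 <| (hasSum_gap σ s hr v).nonpos fun t =>
    mul_nonpos_of_nonneg_of_nonpos (pow_nonneg M.β_pos.le t)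
      (integral_eval_nonpos σ s (M.measurable_gap v.2.1) (M.gap_bounded hr v) h t)

theorem payoff_eq_of_gap_eq_zero (hr : ∃ C : ℝ, ∀ x, |M.r x| ≤ C) (v : BoundedMeasurable S)
    (h : ∀ n k s, M.gap v (s, σ.act n (k, s)) = 0) : payoff σ s = v s := by
  have h0 := hasSum_gap σ s hr v
  simp only [integral_eval_eq_zero σ s (M.measurable_gap v.2.1) (M.gap_bounded hr v) h,
    mul_zero] at h0
  exact sub_eq_zero.1 (h0.unique hasSum_zero)

end Paths

/-! ### Fixed points of the Bellman operator are the value function. -/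

section Verification

variable {M : DiscountedDP S A} {v : BoundedMeasurable S}

theorem payoff_le_of_bellman_eq (hr : ∃ C : ℝ, ∀ x, |M.r x| ≤ C)
    (hv : M.bellman v = v) (σ : M.Strategy) (s : S) : payoff σ s ≤ v s :=
  payoff_le_of_gap_nonpos σ s hr v fun n k s => by
    have := M.Q_le_bellman hr v (σ.feasible n k s)
    rw [hv] at this
    exact sub_nonpos.2 this

theorem payoff_eq_of_mem_maximizers (hr : ∃ C : ℝ, ∀ x, |M.r x| ≤ C)
    (hv : M.bellman v = v) {l : M.StationaryPolicy} (hl : l ∈ M.maximizers v) (s : S) :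
    payoff l.toStrategy s = v s :=
  payoff_eq_of_gap_eq_zero _ s hr v fun _ _ s => by
    have := hl s
    rw [hv] at this
    exact sub_eq_zero.2 this.symm

theorem value_eq_of_bellman_eq (hr : ∃ C : ℝ, ∀ x, |M.r x| ≤ C)
    (hv : M.bellman v = v) (hne : (M.maximizers v).Nonempty) : M.value = v := by
  obtain ⟨l, hl⟩ := hne
  have : Nonempty M.Strategy := ⟨l.toStrategy⟩
  funext s
  refine le_antisymm (ciSup_le fun σ => payoff_le_of_bellman_eq hr hv σ s) ?_
  rw [← payoff_eq_of_mem_maximizers hr hv hl s]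
  exact le_ciSup ⟨v s, Set.forall_mem_range.2 fun σ => payoff_le_of_bellman_eq hr hv σ s⟩ _

end Verification

end DiscountedDP

theorem mainTheorem1
    {S : Type*} [MetricSpace S] [CompleteSpace S] [TopologicalSpace.SeparableSpace S]
    [MeasurableSpace S] [BorelSpace S]
    {k : ℕ} (A : Set (EuclideanSpace ℝ (Fin k))) (_hA : MeasurableSet A)
    (M : DiscountedDP S A)
    (_hr : ∃ C : ℝ, ∀ x : S × A, |M.r x| ≤ C)
    (D : Set (BoundedMeasurable S))
    (_hD_complete : IsComplete D)
    (_hD_const : ∀ c : ℝ, BoundedMeasurable.const S c ∈ D)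
    (_hD_sel : ∀ f ∈ D, (M.maximizers f).Nonempty)
    (_hD_bellman : ∀ f ∈ D, ∃ g ∈ D, (g : S → ℝ) = M.bellman f) :
    -- the value function is the unique fixed point of the Bellman operator in `D`
    ((∃ v ∈ D, (v : S → ℝ) = M.value) ∧ M.bellman M.value = M.value ∧
      ∀ f ∈ D, M.bellman f = (f : S → ℝ) → (f : S → ℝ) = M.value) ∧
    -- some policy in `Λ_V` is `ε`-optimal for every `ε > 0`
    (∃ l ∈ M.maximizers M.value, ∀ ε : ℝ, 0 < ε → DiscountedDP.IsEpsOptimal ε l.toStrategy) ∧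
    -- every policy in `Λ_V` is optimal
    (∀ l ∈ M.maximizers M.value, DiscountedDP.IsOptimal l.toStrategy) ∧
    -- value iteration converges uniformly
    (∀ f ∈ D, TendstoUniformly (fun n : ℕ => M.bellman^[n] (f : S → ℝ)) M.value atTop) ∧
    -- the value function lies in every nonempty closed invariant subset of `D`
    (∀ D' : Set (BoundedMeasurable S), D'.Nonempty → IsClosed D' → D' ⊆ D →
      (∀ f ∈ D', ∃ g ∈ D', (g : S → ℝ) = M.bellman f) →
      ∃ v ∈ D', (v : S → ℝ) = M.value) := by
  have hc0 : BoundedMeasurable.const S 0 ∈ D := _hD_const 0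
  -- A maximizing policy for the constant `0` supplies a feasible action in every state.
  have hΓ : ∀ s, (M.Γ s).Nonempty := fun s =>
    (_hD_sel _ hc0).elim fun l _ => ⟨l.act s, l.feasible s⟩
  choose T hTD hT using _hD_bellman
  let F : D → D := fun f => ⟨T f f.2, hTD f f.2⟩
  have hF : ∀ f : D, ((F f : BoundedMeasurable S) : S → ℝ) = M.bellman (f : BoundedMeasurable S) :=
    fun f => hT f f.2
  have hcontr : ContractingWith ⟨M.β, M.β_pos.le⟩ F := by
    refine ⟨M.β_lt_one, .of_dist_le_mul fun f g => ?_⟩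
    refine BoundedMeasurable.dist_le (mul_nonneg M.β_pos.le dist_nonneg) fun s => ?_
    rw [hF f, hF g]
    exact M.abs_bellman_sub_le _hr hΓ f g s
  have : CompleteSpace D := _hD_complete.completeSpace_coe
  have : Nonempty D := ⟨⟨_, hc0⟩⟩
  obtain ⟨⟨v, hvD⟩, hvF, hlim⟩ : ∃ v : D, F v = v ∧
      ∀ f : D, Tendsto (fun n => F^[n] f) atTop (𝓝 v) :=
    ⟨_, hcontr.fixedPoint_isFixedPt, hcontr.tendsto_iterate_fixedPoint⟩
  have hv : M.bellman v = v := by rw [← hF ⟨v, hvD⟩, hvF]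
  have hval : ∀ f ∈ D, M.bellman f = f → M.value = f := fun f hf h =>
    DiscountedDP.value_eq_of_bellman_eq _hr h (_hD_sel f hf)
  have hV := hval v hvD hv
  have hiter : ∀ (f : D) (n : ℕ),
      M.bellman^[n] (f : BoundedMeasurable S) = ((F^[n] f : D) : BoundedMeasurable S) := by
    intro f n
    induction n with
    | zero => rfl
    | succ n ih => rw [Function.iterate_succ_apply', Function.iterate_succ_apply', ih, hF]
  have hopt : ∀ l ∈ M.maximizers M.value, DiscountedDP.IsOptimal l.toStrategy := by
    rw [hV]
    intro l hl s
    rw [hV]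
    exact DiscountedDP.payoff_eq_of_mem_maximizers _hr hv hl s
  refine ⟨⟨⟨v, hvD, hV.symm⟩, by rw [hV, hv], fun f hf h => (hval f hf h).symm⟩, ?_, hopt, ?_, ?_⟩
  · obtain ⟨l, hl⟩ := _hD_sel v hvD
    rw [← hV] at hl
    refine ⟨l, hl, fun ε hε σ s => ?_⟩
    rw [hopt l hl s, hV]
    exact (DiscountedDP.payoff_le_of_bellman_eq _hr hv σ s).trans (le_add_of_nonneg_right hε.le)
  · intro f hf
    rw [Metric.tendstoUniformly_iff]
    intro ε hε
    filter_upwards [Metric.tendsto_nhds.1 (hlim ⟨f, hf⟩) ε hε] with n hn s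
    rw [dist_comm, hV, hiter ⟨f, hf⟩ n]
    exact (BoundedMeasurable.abs_sub_le_dist _ _ s).trans_lt hn
  · rintro D' ⟨f, hf⟩ hclosed hsub hinv
    have hmem : ∀ n, ((F^[n] ⟨f, hsub hf⟩ : D) : BoundedMeasurable S) ∈ D' := by
      intro n
      induction n with
      | zero => exact hf
      | succ n ih =>
        -- The element `g` of `D'` and the next iterate have the same underlying function, so they
        -- coincide.
        obtain ⟨g, hg, hgT⟩ := hinv _ ih
        rw [Function.iterate_succ_apply']
        exact (Subtype.ext ((hF _).trans hgT.symm) :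
          (F (F^[n] ⟨f, hsub hf⟩) : BoundedMeasurable S) = g) ▸ hg
    exact ⟨v, hclosed.mem_of_tendsto
      ((continuous_subtype_val.tendsto _).comp (hlim ⟨f, hsub hf⟩)) (.of_forall hmem), hV.symm⟩
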